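/- Let $G=(V,E,\omega)$ be a finite weighted directed graph (self-loops allowed, all weights positive) with adjacency matrix $A\in\mathbb R_+^{V\times V}$, $A_{ij}=\omega(ij)$ if $ij\in E$ and $A_{ij}=0$ otherwise. Let $\tilde G$ be a weighted directed graph on $V$, with adjacency matrix $\tilde A$, obtained from $G$ by adding, erasing, or modifying the weights of edges contained in a set $\delta E\subseteq V\times V$, and put $S=\{s : (s,t)\in\delta E\}$, $T=\{t : (s,t)\in\delta E\}$. For $k,\ell\in V$ let $\delta=\mathrm{dist}_G(k,S)+\mathrm{dist}_G(T,\ell)\in\mathbb N\cup\{\infty\}$. Here $\mathrm{dist}_G(u,v)$ is the length of a shortest directed walk in $G$ from $u$ to $v$ ($0$ if $u=v$, $\infty$ if there is none), $\mathrm{dist}_G(k,S)=\min_{s\in S}\mathrm{dist}_G(k,s)$, $\mathrm{dist}_G(T,\ell)=\min_{t\in T}\mathrm{dist}_G(t,\ell)$, and $\min\emptyset=\infty$. Let $\mathcal F(M)=\{x^*Mx : x\in\mathbb C^V,\ \|x\|_2=1\}$ denote the field of values of $M$. If $\delta=\infty$, then $\exp(A)_{k\ell}=\exp(\tilde A)_{k\ell}$.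 Suppose now that $\delta<\infty$, and let $\Omega\subset\mathbb C$ be a set that contains $\mathcal F(A)$ and $\mathcal F(\tilde A)$. If $\Omega$ is bounded and its boundary is a horizontal ellipse with semi-axes $a\ge b>0$ ($a$ horizontal, $b$ vertical) and center $c\in\mathbb C$, and $\delta>b-1$, then $$\left|\left(\exp(A)-\exp(\tilde A)\right)_{k\ell}\right|\le \frac{4e^{\Re(c)}\,p(\delta+1)}{p(\delta+1)-(a+b)/(\delta+1)}\left(\frac{a+b}{\delta+1}\,\frac{e^{q(\delta+1)}}{p(\delta+1)}\right)^{\delta+1},$$ where $q(t)=1+\dfrac{a^2-b^2}{t^2+t\sqrt{t^2+a^2-b^2}}$ and $p(t)=1+\sqrt{1+(a^2-b^2)/t^2}$. Moreover: 1. If $\Omega$ is a disk of radius $a>0$ and center $c\in\mathbb C$, and $\delta>a-1$, then $$\left|\left(\exp(A)-\exp(\tilde A)\right)_{k\ell}\right|\le 4e^{\Re(c)}\,\frac{\delta+1}{\delta+1-a}\left(\frac{a\,e}{\delta+1}\right)^{\delta+1}.$$ 2. If $\Omega$ is a real interval $[c-a,c+a]$ with $c\in\mathbb R$, $a>0$,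 and $\delta>0$, then $$\left|\left(\exp(A)-\exp(\tilde A)\right)_{k\ell}\right|\le \frac{4e^{c}\,p(\delta+1)}{p(\delta+1)-a/(\delta+1)}\left(\frac{a}{\delta+1}\,\frac{e^{q(\delta+1)}}{p(\delta+1)}\right)^{\delta+1},$$ where $q(t)=1+\dfrac{a^2}{t^2+t\sqrt{t^2+a^2}}$ and $p(t)=1+\sqrt{1+(a/t)^2}$. -/

import Mathlib

/-- A weighted directed graph `(V, E, ω)`: a set of edges (self-loops allowed) together with a
positive weight on each edge. -/
structure WeightedDigraph (V : Type*) where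
  edges : Set (V × V)
  weight : edges → ℝ
  weight_pos : ∀ e, 0 < weight e

namespace WeightedDigraph

variable {V : Type*}

open Classical in
/-- The adjacency matrix: the weight of the edge `(i, j)` if there is one, and `0` otherwise. -/
noncomputable def adjMatrix (G : WeightedDigraph V) : Matrix V V ℝ :=
  Matrix.of fun i j => if h : (i, j) ∈ G.edges then G.weight ⟨(i, j), h⟩ else 0

/-- Walks along directed edges; `nil` is the walk of length zero. -/
inductive Walk (G : WeightedDigraph V) : V → V → Type _
  | nil {u : V} : Walk G u u
  | cons {u v w : V} (h : (u, v) ∈ G.edges) (p : Walk G v w) : Walk G u w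

/-- The number of edges of a walk. -/
def Walk.length {G : WeightedDigraph V} : {u v : V} → G.Walk u v → ℕ
  | _, _, .nil => 0
  | _, _, .cons _ p => p.length + 1

/-- The geodesic distance: the length of a shortest walk, `⊤` if there is none. -/
noncomputable def dist (G : WeightedDigraph V) (u v : V) : ℕ∞ :=
  ⨅ p : G.Walk u v, (p.length : ℕ∞)

/-- The distance from a node to a set of nodes. -/
noncomputable def distToSet (G : WeightedDigraph V) (u : V) (S : Set V) : ℕ∞ :=
  ⨅ s ∈ S, G.dist u s

/-- The distance from a set of nodes to a node. -/
noncomputable def distFromSet (G : WeightedDigraph V) (S : Set V) (u : V) : ℕ∞ :=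
  ⨅ s ∈ S, G.dist s u

/-- `G'` is obtained from `G` by adding, erasing, or modifying the weights of edges that all lie
in `δE`: outside `δE` the two graphs have the same edges with the same weights. -/
def IsModification (G G' : WeightedDigraph V) (δE : Set (V × V)) : Prop :=
  ∀ e, e ∉ δE → (e ∈ G'.edges ↔ e ∈ G.edges) ∧
    ∀ (h' : e ∈ G'.edges) (h : e ∈ G.edges), G'.weight ⟨e, h'⟩ = G.weight ⟨e, h⟩

end WeightedDigraph

/-- The field of values `{x* A x : x ∈ ℂᴺ, ‖x‖₂ = 1}` of a real matrix `A`. -/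
def fieldOfValues {V : Type*} [Fintype V] (A : Matrix V V ℝ) : Set ℂ :=
  {z | ∃ x : EuclideanSpace ℂ V, ‖x‖ = 1 ∧
    z = dotProduct (star x.ofLp) (Matrix.mulVec (A.map Complex.ofReal) x.ofLp)}

/-- The horizontal ellipse (a curve) with center `c`, horizontal semi-axis `a` and vertical
semi-axis `b`. -/
def horizontalEllipse (c : ℂ) (a b : ℝ) : Set ℂ :=
  {z | ((z.re - c.re) / a) ^ 2 + ((z.im - c.im) / b) ^ 2 = 1}

/-- `p(t) = 1 + √(1 + r / t²)`. -/
noncomputable def expBoundP (r t : ℝ) : ℝ := 1 + √(1 + r / t ^ 2)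

/-- `q(t) = 1 + r / (t² + t √(t² + r))`. -/
noncomputable def expBoundQ (r t : ℝ) : ℝ := 1 + r / (t ^ 2 + t * √(t ^ 2 + r))

/-!
The entries of `A ^ m` and `A' ^ m` at `(k, l)` agree for `m ≤ d`: in the telescoping sum of
`A ^ i * (A - A') * A' ^ j` with `i + j + 1 = m`, a nonzero term would give a walk in `G` of length
at most `i` from `k` to `S` and, after the last modified edge, a walk in `G` of length at most `j`
from `T` to `l` (`WeightedDigraph.IsModification.pow_adjMatrix_apply_eq`). So polynomials of degree
at most `d` take the same value at `(k, l)` on both matrices, and only the higher terms of an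
expansion of the exponential matter.

The expansion is in the Faber polynomials of the ellipse with semi-axes `a ≥ b ≥ 0` (a disk for
`a = b`, an interval for `b = 0`). With `κ = (a - b) / (a + b)` and `B = 2 (A - c) / (a + b)`, the
exterior map of the ellipse of `B` is `w ↦ w + κ / w`, and its Faber polynomials are the Dickson
polynomials `D n`, characterised by `D n (w + κ / w) = w ^ n + (κ / w) ^ n`.

* Beckermann's bound. If the numerical range of `B` lies in the ellipse with semi-axes `1 + κ` and
  `1 - κ`, then the generating function `P z = (1 - κ z²) (1 + κ z² - z B)⁻¹ = 1 + ∑ zⁿ D n (B)`,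
  `n ≥ 1`, is analytic on the unit disk and `re ⟪x, P z x⟫ ≥ 0` there, because the normal of the ellipse
  through `w + κ / w`, `w = z⁻¹`, has direction `w - κ / w`. As for Carathéodory functions, the
  coefficients of an analytic function with nonnegative real part and value `1` at `0` have norm
  at most `2` (`norm_inner_le_of_accretive_generating`).
* A majorant. `X ^ m` is a combination of the `D n` with nonnegative coefficients, and
  `rⁿ ≤ D n (r + κ / r)`. For `r ≥ 1`, a linear map that vanishes on `D n` for `n < t` and has norm
  at most `M` on every `D n` is therefore bounded by `M r⁻ᵗ (r + κ / r) ^ m` on `X ^ m`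
  (`norm_dickson_expansion_X_pow_le`). With `M = 2 + 2` and `t = d + 1`, summing the exponential
  series gives the bound of `abs_exp_sub_exp_apply_le`.

The stated bounds follow with `r = t p(t) / (a + b)`, which minimises the resulting expression
(`optimal_radius_bound`); their factor `p / (p - (a + b) / t)` is at least `1`.
-/

/-! ### Circle averages and Fourier coefficients -/

section CircleAverage

open Complex ComplexConjugate Metric
open scoped InnerProductSpace Nat

variable {𝔸 : Type*} [NormedRing 𝔸] [NormedAlgebra ℂ 𝔸] [CompleteSpace 𝔸]

lemma circleAverage_conj_pow_succ_smul_const (m : ℕ) (ρ : ℝ) (a : 𝔸) :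
    Real.circleAverage (fun z : ℂ => (conj z) ^ (m + 1) • a) 0 ρ = 0 := by
  have h1 : Real.circleAverage (fun z : ℂ => z ^ (m + 1)) 0 ρ = 0 := by
    rw [DiffContOnCl.circleAverage (Differentiable.diffContOnCl (by fun_prop))]
    simp
  have h2 : Real.circleAverage (fun z : ℂ => (conj z) ^ (m + 1)) 0 ρ = 0 := by
    have := (Complex.conjCLE : ℂ →L[ℝ] ℂ).circleAverage_comp_comm (f := fun z : ℂ => z ^ (m + 1))
      (c := 0) (R := ρ) (by exact ContinuousOn.circleIntegrable' (by fun_prop))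
    rw [h1] at this
    simpa [Function.comp_def] using this
  have := ((ContinuousLinearMap.toSpanSingleton ℂ a).restrictScalars ℝ).circleAverage_comp_comm
      (f := fun z : ℂ => (conj z) ^ (m + 1))
      (c := 0) (R := ρ) (by exact ContinuousOn.circleIntegrable' (by fun_prop))
  rw [h2] at this
  simpa [Function.comp_def] using this

lemma differentiableOn_ringInverse {N : ℂ → 𝔸} (hN : Differentiable ℂ N)
    (hunit : ∀ z ∈ ball (0 : ℂ) 1, IsUnit (N z)) :
    DifferentiableOn ℂ (fun z => Ring.inverse (N z)) (ball 0 1) := by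
  intro z hz
  obtain ⟨u, hu⟩ := hunit z hz
  have h : DifferentiableAt ℂ Ring.inverse (N z) := by
    rw [← hu]; exact differentiableAt_inverse u.isUnit
  exact (h.comp z (hN z)).differentiableWithinAt

lemma circleAverage_eq_of_differentiableOn {F : Type*} [NormedAddCommGroup F] [NormedSpace ℂ F]
    [CompleteSpace F] {f : ℂ → F}
    (hf : DifferentiableOn ℂ f (ball 0 1)) {ρ : ℝ} (h0 : 0 < ρ) (h1 : ρ < 1) :
    Real.circleAverage f 0 ρ = f 0 := by
  apply DiffContOnCl.circleAverage
  apply DifferentiableOn.diffContOnCl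
  refine hf.mono ?_
  rw [abs_of_pos h0]
  exact closure_ball_subset_closedBall.trans (closedBall_subset_ball h1)

lemma circleIntegrable_of_continuousOn {F : Type*} [NormedAddCommGroup F] [NormedSpace ℂ F]
    {f : ℂ → F} (hf : ContinuousOn f (ball 0 1)) {ρ : ℝ} (h0 : 0 < ρ) (h1 : ρ < 1) :
    CircleIntegrable f 0 ρ :=
  (hf.mono (sphere_subset_closedBall.trans (closedBall_subset_ball h1))).circleIntegrable h0.le

/-- Let `N z = 1 + κ z² - z B`. The functions `R j z = (N z)⁻¹ (C j - κ z C (j - 1))`, `1 ≤ j`,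
satisfy `R j = C j + z R (j + 1)`, so they are the tails `∑ zⁱ C (j + i)`. The lemma extracts the
`m`-th coefficient of `R (j + 1)`, by induction on `m` along this identity; the factor
`(conj z) ^ m` is `ρ ^ (2 m) z⁻ᵐ` on the circle. -/
theorem circleAverage_conj_pow_smul_tail {B : 𝔸} {κ : ℂ} {C : ℕ → 𝔸}
    (hC : ∀ n, C (n + 2) = B * C (n + 1) - κ • C n)
    (hunit : ∀ z ∈ ball (0 : ℂ) 1, IsUnit ((1 + κ * z ^ 2) • (1 : 𝔸) - z • B))
    {ρ : ℝ} (h0 : 0 < ρ) (h1 : ρ < 1) (m j : ℕ) :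
    Real.circleAverage (fun z : ℂ => (conj z) ^ m •
      (Ring.inverse ((1 + κ * z ^ 2) • (1 : 𝔸) - z • B) * (C (j + 1) - (κ * z) • C j))) 0 ρ =
      ((ρ : ℂ) ^ 2) ^ m • C (j + 1 + m) := by
  have hinv := differentiableOn_ringInverse (by fun_prop) hunit
  have hdiff : ∀ j, DifferentiableOn ℂ (fun z : ℂ =>
      Ring.inverse ((1 + κ * z ^ 2) • (1 : 𝔸) - z • B) * (C (j + 1) - (κ * z) • C j)) (ball 0 1) :=
    fun j => hinv.mul (by fun_prop)
  induction m generalizing j with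
  | zero =>
    simp only [pow_zero, one_smul]
    rw [circleAverage_eq_of_differentiableOn (hdiff j) h0 h1]
    simp
  | succ m ih =>
    have hstep : Set.EqOn (fun z : ℂ => (conj z) ^ (m + 1) •
        (Ring.inverse ((1 + κ * z ^ 2) • (1 : 𝔸) - z • B) * (C (j + 1) - (κ * z) • C j)))
        (fun z : ℂ => (conj z) ^ (m + 1) • C (j + 1) + (ρ : ℂ) ^ 2 • ((conj z) ^ m •
        (Ring.inverse ((1 + κ * z ^ 2) • (1 : 𝔸) - z • B) *
          (C (j + 2) - (κ * z) • C (j + 1))))) (sphere 0 |ρ|) := by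
      intro z hz
      have hzn : ‖z‖ = ρ := by simpa [abs_of_pos h0] using hz
      have hu := hunit z (by simpa [hzn] using h1)
      have hzz : conj z * z = (ρ : ℂ) ^ 2 := by rw [Complex.conj_mul', hzn]
      have key : Ring.inverse ((1 + κ * z ^ 2) • (1 : 𝔸) - z • B) * (C (j + 1) - (κ * z) • C j) =
          C (j + 1) + z • (Ring.inverse ((1 + κ * z ^ 2) • (1 : 𝔸) - z • B) *
          (C (j + 2) - (κ * z) • C (j + 1))) := by
        set N := (1 + κ * z ^ 2) • (1 : 𝔸) - z • B with hNdef
        have e : C (j + 1) - (κ * z) • C j =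
            N * C (j + 1) + z • (C (j + 2) - (κ * z) • C (j + 1)) := by
          rw [hC, hNdef, sub_mul, smul_mul_assoc, smul_mul_assoc, one_mul]
          module
        rw [e, mul_add, ← mul_assoc, Ring.inverse_mul_cancel _ hu, one_mul, mul_smul_comm]
      simp only
      rw [key, ← hzz]
      module
    rw [Real.circleAverage_congr_sphere hstep, Real.circleAverage_fun_add,
      circleAverage_conj_pow_succ_smul_const, zero_add, Real.circleAverage_fun_smul, ih, smul_smul,
      pow_succ' ((ρ : ℂ) ^ 2)]
    · rw [show j + 1 + 1 + m = j + 1 + (m + 1) by omega]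
    · exact ContinuousOn.circleIntegrable' (by fun_prop)
    · apply circleIntegrable_of_continuousOn _ h0 h1
      exact ContinuousOn.const_smul (ContinuousOn.smul (by fun_prop) (hdiff (j+1)).continuousOn) _

/-- The positive coefficients of the generating function `(1 - κ z²) (1 + κ z² - z B)⁻¹` are the
`C n`: it equals `1 + z R 1`, with `R 1` the first of the functions of
`circleAverage_conj_pow_smul_tail`. -/
theorem circleAverage_conj_pow_smul_generating {B : 𝔸} {κ : ℂ} {C : ℕ → 𝔸}
    (hC0 : C 0 = (2 : ℂ) • 1) (hC1 : C 1 = B) (hC : ∀ n, C (n + 2) = B * C (n + 1) - κ • C n)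
    (hunit : ∀ z ∈ ball (0 : ℂ) 1, IsUnit ((1 + κ * z ^ 2) • (1 : 𝔸) - z • B))
    {ρ : ℝ} (h0 : 0 < ρ) (h1 : ρ < 1) (n : ℕ) :
    Real.circleAverage (fun z : ℂ => (conj z) ^ (n + 1) •
      ((1 - κ * z ^ 2) • Ring.inverse ((1 + κ * z ^ 2) • (1 : 𝔸) - z • B))) 0 ρ =
      ((ρ : ℂ) ^ 2) ^ (n + 1) • C (n + 1) := by
  have hinv := differentiableOn_ringInverse (by fun_prop) hunit
  have hstep : Set.EqOn (fun z : ℂ => (conj z) ^ (n + 1) •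
        ((1 - κ * z ^ 2) • Ring.inverse ((1 + κ * z ^ 2) • (1 : 𝔸) - z • B)))
        (fun z : ℂ => (conj z) ^ (n + 1) • (1 : 𝔸) + (ρ : ℂ) ^ 2 • ((conj z) ^ n •
        (Ring.inverse ((1 + κ * z ^ 2) • (1 : 𝔸) - z • B) *
          (C (0 + 1) - (κ * z) • C 0)))) (sphere 0 |ρ|) := by
      intro z hz
      have hzn : ‖z‖ = ρ := by simpa [abs_of_pos h0] using hz
      have hu := hunit z (by simpa [hzn] using h1)
      have hzz : conj z * z = (ρ : ℂ) ^ 2 := by rw [Complex.conj_mul', hzn]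
      have key : (1 - κ * z ^ 2) • Ring.inverse ((1 + κ * z ^ 2) • (1 : 𝔸) - z • B) =
          1 + z • (Ring.inverse ((1 + κ * z ^ 2) • (1 : 𝔸) - z • B) *
          (C (0 + 1) - (κ * z) • C 0)) := by
        set N := (1 + κ * z ^ 2) • (1 : 𝔸) - z • B with hNdef
        have e : (1 - κ * z ^ 2) • (1 : 𝔸) = N + z • (C (0 + 1) - (κ * z) • C 0) := by
          rw [zero_add, hC1, hC0, hNdef]
          module
        rw [← mul_one (Ring.inverse N), ← mul_smul_comm, e, mul_add, Ring.inverse_mul_cancel _ hu,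
          mul_smul_comm, mul_one]
      simp only
      rw [key, ← hzz]
      module
  rw [Real.circleAverage_congr_sphere hstep, Real.circleAverage_fun_add,
      circleAverage_conj_pow_succ_smul_const, zero_add, Real.circleAverage_fun_smul,
      circleAverage_conj_pow_smul_tail hC hunit h0 h1, smul_smul,
      pow_succ' ((ρ : ℂ) ^ 2), zero_add, add_comm 1 n]
  · exact ContinuousOn.circleIntegrable' (by fun_prop)
  · apply circleIntegrable_of_continuousOn _ h0 h1
    have := hinv.continuousOn
    exact ContinuousOn.const_smul (ContinuousOn.smul (by fun_prop) (this.mul (by fun_prop))) _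

lemma norm_circleAverage_le {f : ℂ → ℂ} {c : ℂ} {R : ℝ} :
    ‖Real.circleAverage f c R‖ ≤ Real.circleAverage (fun z => ‖f z‖) c R := by
  rw [Real.circleAverage, Real.circleAverage, norm_smul, smul_eq_mul, Real.norm_of_nonneg
    (by positivity)]
  gcongr
  exact intervalIntegral.norm_integral_le_integral_norm (by positivity)

end CircleAverage

/-! ### Operators with numerical range in an ellipse -/

section Accretive

open Complex ComplexConjugate Metric
open scoped InnerProductSpace Nat

variable {E : Type*} [NormedAddCommGroup E] [InnerProductSpace ℂ E]

/-- The Hermitian form `⟪y, (P + P*) x⟫` of an operator with nonnegative real part is bounded by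
half the sum of its diagonal values `2 re ⟪x, P x⟫` and `2 re ⟪y, P y⟫`. -/
lemma norm_inner_add_conj_inner_le (P : E →L[ℂ] E) (hP : ∀ x, 0 ≤ (⟪x, P x⟫_ℂ).re) (x y : E) :
    ‖⟪y, P x⟫_ℂ + conj ⟪x, P y⟫_ℂ‖ ≤ (⟪x, P x⟫_ℂ).re + (⟪y, P y⟫_ℂ).re := by
  set h := ⟪y, P x⟫_ℂ + conj ⟪x, P y⟫_ℂ with hh
  obtain ⟨ω, hω1, hω⟩ : ∃ ω : ℂ, conj ω * ω = 1 ∧ conj ω * h = ‖h‖ := by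
    by_cases h0 : h = 0
    · exact ⟨1, by simp, by simp [h0]⟩
    · have hn : (‖h‖ : ℂ) ≠ 0 := by simpa using h0
      have h2 : conj h * h = (‖h‖ : ℂ) ^ 2 := Complex.conj_mul' h
      refine ⟨h / ‖h‖, ?_, ?_⟩
      · rw [map_div₀, Complex.conj_ofReal]; field_simp; exact h2
      · rw [map_div₀, Complex.conj_ofReal]; field_simp; exact h2
  have hp := hP (x - ω • y)
  have e : ⟪x - ω • y, P (x - ω • y)⟫_ℂ = ⟪x, P x⟫_ℂ + conj ω * ω * ⟪y, P y⟫_ℂ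
      - (ω * ⟪x, P y⟫_ℂ + conj ω * ⟪y, P x⟫_ℂ) := by
    simp only [map_sub, map_smul, inner_sub_left, inner_sub_right, inner_smul_left,
      inner_smul_right]
    ring
  have e2 : (ω * ⟪x, P y⟫_ℂ + conj ω * ⟪y, P x⟫_ℂ).re = ‖h‖ := by
    have : (ω * ⟪x, P y⟫_ℂ).re = (conj ω * conj ⟪x, P y⟫_ℂ).re := by
      rw [← map_mul, Complex.conj_re]
    rw [Complex.add_re, this, ← Complex.add_re, ← mul_add, add_comm (conj _), ← hh, hω,
      Complex.ofReal_re]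
  rw [e, Complex.sub_re, e2, hω1, one_mul, Complex.add_re] at hp
  linarith

variable [FiniteDimensional ℂ E]

lemma isUnit_of_re_mul_inner_pos (N : E →L[ℂ] E) (w : ℂ)
    (h : ∀ x ≠ 0, 0 < (w * ⟪x, N x⟫_ℂ).re) : IsUnit N := by
  have : CompleteSpace E := FiniteDimensional.complete ℂ E
  have hinj : Function.Injective N := by
    rw [injective_iff_map_eq_zero]
    intro x hx
    by_contra hne
    simpa [hx] using h x hne
  rw [ContinuousLinearMap.isUnit_iff_bijective]
  exact ⟨hinj, LinearMap.injective_iff_surjective (f := (N : E →ₗ[ℂ] E)).1 hinj⟩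

/-- With `y = N x`, the number `⟪y, w N⁻¹ y⟫` is the conjugate of `conj w * ⟪x, N x⟫`. -/
lemma re_inner_smul_inverse_nonneg (N : E →L[ℂ] E) (w : ℂ)
    (h : ∀ x ≠ 0, 0 < (conj w * ⟪x, N x⟫_ℂ).re) (y : E) :
    0 ≤ (⟪y, (w • Ring.inverse N) y⟫_ℂ).re := by
  have hu := isUnit_of_re_mul_inner_pos N _ h
  set x := Ring.inverse N y with hx
  have hy : N x = y := by
    rw [hx, ← mul_apply_eq_comp, Ring.mul_inverse_cancel _ hu]; rfl
  have e : (⟪y, (w • Ring.inverse N) y⟫_ℂ).re = (conj w * ⟪x, N x⟫_ℂ).re := by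
    rw [smul_apply, ← hx, inner_smul_right, ← hy, ← Complex.conj_re, map_mul,
      inner_conj_symm]
  rw [e]
  by_cases h0 : x = 0
  · simp [h0]
  · exact (h x h0).le

/-- Carathéodory's coefficient estimate for the generating function
`P z = (1 - κ z²) (1 + κ z² - z B)⁻¹`, whose coefficients are the `C n`; `hpos` makes it well
defined with nonnegative real part on the unit disk. The conjugate of `⟪x, P z y⟫` has no Fourier
coefficient of positive index, so `⟪y, C (n + 1) x⟫` is also a coefficient of `⟪y, (P + P*) x⟫`,
which is a positive form with average `⟪y, 2 x⟫`. -/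
theorem norm_inner_le_of_accretive_generating {B : E →L[ℂ] E} {κ : ℂ} {C : ℕ → E →L[ℂ] E}
    (hC0 : C 0 = (2 : ℂ) • 1) (hC1 : C 1 = B) (hC : ∀ n, C (n + 2) = B * C (n + 1) - κ • C n)
    (hpos : ∀ z ∈ ball (0 : ℂ) 1, ∀ x ≠ 0, 0 < (conj (1 - κ * z ^ 2) *
      ⟪x, ((1 + κ * z ^ 2) • (1 : E →L[ℂ] E) - z • B) x⟫_ℂ).re)
    (n : ℕ) (x y : E) : ‖⟪y, C (n + 1) x⟫_ℂ‖ ≤ ‖x‖ ^ 2 + ‖y‖ ^ 2 := by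
  have : CompleteSpace E := FiniteDimensional.complete ℂ E
  have hunit : ∀ z ∈ ball (0 : ℂ) 1, IsUnit ((1 + κ * z ^ 2) • (1 : E →L[ℂ] E) - z • B) :=
    fun z hz => isUnit_of_re_mul_inner_pos _ _ (hpos z hz)
  have hinv := differentiableOn_ringInverse (by fun_prop) hunit
  set P : ℂ → E →L[ℂ] E := fun z =>
    (1 - κ * z ^ 2) • Ring.inverse ((1 + κ * z ^ 2) • (1 : E →L[ℂ] E) - z • B) with hPdef
  have hPd : DifferentiableOn ℂ P (ball 0 1) :=
    (by fun_prop : DifferentiableOn ℂ (fun z => 1 - κ * z ^ 2) (ball 0 1)).smul hinv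
  have hP0 : P 0 = 1 := by simp [hPdef]
  let L : E → E → (E →L[ℂ] E) →L[ℂ] ℂ := fun y x =>
    (innerSL ℂ y).comp (ContinuousLinearMap.apply ℂ E x)
  have hL : ∀ y x T, L y x T = ⟪y, T x⟫_ℂ := fun _ _ _ => rfl
  have hgd : ∀ y x, DifferentiableOn ℂ (fun z => ⟪y, P z x⟫_ℂ) (ball 0 1) := fun y x =>
    (L y x).differentiable.comp_differentiableOn hPd
  have hgc : ∀ y x, ContinuousOn (fun z => ⟪y, P z x⟫_ℂ) (ball 0 1) :=
    fun y x => (hgd y x).continuousOn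
  have key : ∀ ρ : ℝ, 0 < ρ → ρ < 1 →
      ρ ^ (n + 1) * ‖⟪y, C (n + 1) x⟫_ℂ‖ ≤ ‖x‖ ^ 2 + ‖y‖ ^ 2 := by
    intro ρ h0 h1
    have a1 : Real.circleAverage (fun z : ℂ => (conj z) ^ (n + 1) * ⟪y, P z x⟫_ℂ) 0 ρ =
        ((ρ : ℂ) ^ 2) ^ (n + 1) * ⟪y, C (n + 1) x⟫_ℂ := by
      have := ((L y x).restrictScalars ℝ).circleAverage_comp_comm
        (f := fun z : ℂ => (conj z) ^ (n + 1) • P z) (c := 0) (R := ρ)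
        (circleIntegrable_of_continuousOn
          ((by fun_prop : ContinuousOn (fun z : ℂ => conj z ^ (n + 1)) (ball 0 1)).smul
            hPd.continuousOn) h0 h1)
      rw [circleAverage_conj_pow_smul_generating hC0 hC1 hC hunit h0 h1] at this
      simpa [Function.comp_def, hL, inner_smul_right] using this
    have a2 : Real.circleAverage (fun z : ℂ => (conj z) ^ (n + 1) * conj ⟪x, P z y⟫_ℂ) 0 ρ = 0 := by
      have hd : DifferentiableOn ℂ (fun z => z ^ (n + 1) * ⟪x, P z y⟫_ℂ) (ball 0 1) :=
        (by fun_prop : DifferentiableOn ℂ (fun z : ℂ => z ^ (n + 1)) (ball 0 1)).mul (hgd x y)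
      have := (Complex.conjCLE : ℂ →L[ℝ] ℂ).circleAverage_comp_comm
        (circleIntegrable_of_continuousOn hd.continuousOn h0 h1)
      rw [circleAverage_eq_of_differentiableOn hd h0 h1] at this
      simpa [Function.comp_def] using this
    have a3 : ∀ v, Real.circleAverage (fun z : ℂ => (⟪v, P z v⟫_ℂ).re) 0 ρ = ‖v‖ ^ 2 := by
      intro v
      have := Complex.reCLM.circleAverage_comp_comm
        (circleIntegrable_of_continuousOn (hgc v v) h0 h1)
      rw [circleAverage_eq_of_differentiableOn (hgd v v) h0 h1, hP0] at this
      simp only [Function.comp_def, Complex.reCLM_apply] at this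
      rw [this]
      simp [← Complex.ofReal_pow]
    have a4 : Real.circleAverage (fun z : ℂ => (conj z) ^ (n + 1) *
        (⟪y, P z x⟫_ℂ + conj ⟪x, P z y⟫_ℂ)) 0 ρ = ((ρ : ℂ) ^ 2) ^ (n + 1) * ⟪y, C (n + 1) x⟫_ℂ := by
      simp only [mul_add]
      rw [Real.circleAverage_fun_add, a1, a2, add_zero]
      · exact circleIntegrable_of_continuousOn
          ((by fun_prop : ContinuousOn (fun z : ℂ => conj z ^ (n + 1)) (ball 0 1)).mul
            (hgc y x)) h0 h1
      · exact circleIntegrable_of_continuousOn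
          ((by fun_prop : ContinuousOn (fun z : ℂ => conj z ^ (n + 1)) (ball 0 1)).mul
            (Complex.continuous_conj.comp_continuousOn (hgc x y))) h0 h1
    have hre : ∀ v, CircleIntegrable (fun z : ℂ => (⟪v, P z v⟫_ℂ).re) 0 ρ := fun v =>
      ((Complex.continuous_re.comp_continuousOn (hgc v v)).mono
        (sphere_subset_closedBall.trans (closedBall_subset_ball h1))).circleIntegrable h0.le
    have a5 : ‖((ρ : ℂ) ^ 2) ^ (n + 1) * ⟪y, C (n + 1) x⟫_ℂ‖ ≤
        ρ ^ (n + 1) * (‖x‖ ^ 2 + ‖y‖ ^ 2) := by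
      rw [← a4, ← a3 x, ← a3 y, ← Real.circleAverage_fun_add (hre x) (hre y), ← smul_eq_mul,
        ← Real.circleAverage_fun_smul]
      refine norm_circleAverage_le.trans (Real.circleAverage_mono ?_ ?_ ?_)
      · exact ((((by fun_prop : ContinuousOn (fun z : ℂ => conj z ^ (n + 1)) (ball 0 1)).mul ((hgc y x).add
          (Complex.continuous_conj.comp_continuousOn (hgc x y)))).norm).mono
          (sphere_subset_closedBall.trans (closedBall_subset_ball h1))).circleIntegrable h0.le
      · exact ((hre x).add (hre y)).const_smul
      · intro z hz
        have hzn : ‖z‖ = ρ := by simpa [abs_of_pos h0] using hz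
        simp only [norm_mul, norm_pow, Complex.norm_conj, hzn, smul_eq_mul]
        gcongr
        exact norm_inner_add_conj_inner_le _
          (re_inner_smul_inverse_nonneg _ _ (hpos z (by simpa [hzn] using h1))) _ _
    rw [norm_mul, norm_pow, norm_pow, Complex.norm_real, Real.norm_of_nonneg h0.le, ← pow_mul,
      two_mul, pow_add, mul_assoc] at a5
    exact le_of_mul_le_mul_left a5 (by positivity)
  have hlim : Filter.Tendsto (fun ρ : ℝ => ρ ^ (n + 1) * ‖⟪y, C (n + 1) x⟫_ℂ‖)
      (nhdsWithin 1 (Set.Iio 1)) (nhds (1 ^ (n + 1) * ‖⟪y, C (n + 1) x⟫_ℂ‖)) :=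
    (Continuous.tendsto (by fun_prop) 1).mono_left nhdsWithin_le_nhds
  rw [one_pow, one_mul] at hlim
  refine le_of_tendsto hlim ?_
  filter_upwards [Ioo_mem_nhdsLT (zero_lt_one' ℝ)] with ρ hρ using key ρ hρ.1 hρ.2

/-- With `w = z⁻¹`, the supporting half-plane of the confocal ellipse through `w + κ / w`, which has
normal direction `w - κ / w`, contains the inner ellipse with semi-axes `1 + κ` and `1 - κ` in its
interior. The inner product expressing this is multiplied by `|z|²`. -/
lemma re_conj_mul_ellipse_pos {κ u v : ℝ} (hκ0 : 0 ≤ κ) (hκ1 : κ ≤ 1) (huv : u ^ 2 + v ^ 2 ≤ 1)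
    {z : ℂ} (hz : z ∈ ball (0 : ℂ) 1) :
    0 < (conj (1 - κ * z ^ 2) *
      (1 + κ * z ^ 2 - z * ((1 + κ) * u + (1 - κ) * v * Complex.I))).re := by
  obtain ⟨s, t⟩ := z
  have hρ1 : ‖(⟨s, t⟩ : ℂ)‖ < 1 := by simpa using hz
  set ρ := ‖(⟨s, t⟩ : ℂ)‖ with hρ
  have hρ0 : 0 ≤ ρ := norm_nonneg _
  have hst : ρ ^ 2 = s ^ 2 + t ^ 2 := by
    rw [hρ, ← Complex.normSq_eq_norm_sq, Complex.normSq_mk]; ring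
  have e : (conj (1 - κ * (⟨s, t⟩ : ℂ) ^ 2) * (1 + κ * (⟨s, t⟩ : ℂ) ^ 2 -
      (⟨s, t⟩ : ℂ) * ((1 + κ) * u + (1 - κ) * v * Complex.I))).re =
      (1 - κ * ρ ^ 2) * (1 + κ * ρ ^ 2) -
        ((1 - κ * ρ ^ 2) * (1 + κ) * (u * s) - (1 + κ * ρ ^ 2) * (1 - κ) * (v * t)) := by
    rw [hst]
    simp [pow_two]
    ring
  rw [e]
  have hus : |u * s| + |v * t| ≤ ρ := by
    rw [abs_mul, abs_mul]
    refine abs_le_of_sq_le_sq' ?_ hρ0 |>.2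
    rw [hst]
    have h1 := sq_abs u
    have h2 := sq_abs v
    have h3 := sq_abs s
    have h4 := sq_abs t
    nlinarith [sq_nonneg (|u| * |t| - |v| * |s|), sq_nonneg |s|, sq_nonneg |t|]
  have hκρ : κ * ρ ^ 2 < 1 := by nlinarith
  have hX : (1 + κ) * ρ < 1 + κ * ρ ^ 2 := by
    have : 0 < (1 - ρ) * (1 - κ * ρ) := mul_pos (by linarith) (by nlinarith)
    linarith
  have hY : (1 - κ) * ρ < 1 - κ * ρ ^ 2 := by
    have : 0 < (1 - ρ) * (1 + κ * ρ) := mul_pos (by linarith) (by positivity)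
    linarith
  have hp : 0 < 1 - κ * ρ ^ 2 := by linarith
  have hq : 0 < 1 + κ * ρ ^ 2 := by positivity
  -- both weights are at most `M`, and `M * ρ < (1 - κ ρ²) (1 + κ ρ²)`
  set M := max ((1 - κ * ρ ^ 2) * (1 + κ)) ((1 + κ * ρ ^ 2) * (1 - κ)) with hM
  have hM0 : 0 ≤ M := le_max_of_le_left (by positivity)
  have hMρ : M * ρ < (1 - κ * ρ ^ 2) * (1 + κ * ρ ^ 2) := by
    rcases max_choice ((1 - κ * ρ ^ 2) * (1 + κ)) ((1 + κ * ρ ^ 2) * (1 - κ)) with h | h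
    · rw [hM, h, mul_assoc]; exact mul_lt_mul_of_pos_left hX hp
    · rw [hM, h, mul_assoc, mul_comm (1 - κ * ρ ^ 2)]; exact mul_lt_mul_of_pos_left hY hq
  have h1 : (1 - κ * ρ ^ 2) * (1 + κ) * (u * s) ≤ M * |u * s| :=
    (mul_le_mul_of_nonneg_left (le_abs_self _) (by positivity)).trans
      (mul_le_mul_of_nonneg_right (le_max_left _ _) (abs_nonneg _))
  have h2 : (1 + κ * ρ ^ 2) * (1 - κ) * -(v * t) ≤ M * |v * t| :=
    (mul_le_mul_of_nonneg_left (neg_le_abs _) (mul_nonneg hq.le (by linarith))).trans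
      (mul_le_mul_of_nonneg_right (le_max_right _ _) (abs_nonneg _))
  have h3 := mul_le_mul_of_nonneg_left hus hM0
  linarith

/-- Beckermann's bound for the Faber polynomials `C n` of the ellipse with semi-axes `1 + κ` and
`1 - κ` and center `0`. The parametrisation `(1 + κ) u + (1 - κ) v i`, `u² + v² ≤ 1`, of the filled
ellipse also covers the interval `κ = 1`. -/
theorem norm_inner_le_two_of_numericalRange_subset_ellipse {B : E →L[ℂ] E} {κ : ℝ}
    (hκ0 : 0 ≤ κ) (hκ1 : κ ≤ 1)
    (hB : ∀ x : E, ‖x‖ = 1 → ∃ u v : ℝ, u ^ 2 + v ^ 2 ≤ 1 ∧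
      ⟪x, B x⟫_ℂ = (1 + κ) * u + (1 - κ) * v * Complex.I)
    {C : ℕ → E →L[ℂ] E} (hC0 : C 0 = (2 : ℂ) • 1) (hC1 : C 1 = B)
    (hC : ∀ n, C (n + 2) = B * C (n + 1) - (κ : ℂ) • C n)
    (n : ℕ) {x y : E} (hx : ‖x‖ = 1) (hy : ‖y‖ = 1) : ‖⟪y, C n x⟫_ℂ‖ ≤ 2 := by
  rcases n with _ | n
  · have := norm_inner_le_norm (𝕜 := ℂ) y x
    rw [hx, hy] at this
    simp only [hC0, smul_apply, inner_smul_right, one_apply_eq_self, norm_mul]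
    norm_num
    linarith
  refine (norm_inner_le_of_accretive_generating hC0 hC1 hC ?_ n x y).trans ?_
  · intro z hz w hw
    set e := (‖w‖⁻¹ : ℂ) • w with he
    have hwn : (‖w‖ : ℂ) ≠ 0 := by simpa using hw
    have hen : ‖e‖ = 1 := by rw [he, norm_smul]; simp [hw]
    obtain ⟨u, v, huv, hBe⟩ := hB e hen
    have hwe : w = (‖w‖ : ℂ) • e := by rw [he, smul_smul, mul_inv_cancel₀ hwn, one_smul]
    have hee : ⟪e, e⟫_ℂ = 1 := by rw [inner_self_eq_norm_sq_to_K, hen]; simp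
    have hN : ⟪w, ((1 + κ * z ^ 2) • (1 : E →L[ℂ] E) - z • B) w⟫_ℂ = ((‖w‖ ^ 2 : ℝ) : ℂ) *
        (1 + κ * z ^ 2 - z * ((1 + κ) * u + (1 - κ) * v * Complex.I)) := by
      rw [← hBe]
      conv_lhs => rw [hwe]
      simp only [map_smul, inner_smul_left, inner_smul_right, sub_apply, smul_apply,
        one_apply_eq_self, inner_sub_right, hee, Complex.conj_ofReal]
      push_cast
      ring
    rw [hN, mul_left_comm, Complex.re_ofReal_mul]
    exact mul_pos (by positivity) (re_conj_mul_ellipse_pos hκ0 hκ1 huv hz)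
  · rw [hx, hy]; norm_num

end Accretive

/-! ### Dickson polynomials -/

section Dickson

open Complex ComplexConjugate Metric
open scoped InnerProductSpace Nat

open Polynomial

lemma dickson_one_eval_add {R : Type*} [CommRing R] (x y : R) :
    ∀ n, (dickson 1 (x * y) n).eval (x + y) = x ^ n + y ^ n
  | 0 => by simp [dickson_zero]; norm_num
  | 1 => by simp
  | n + 2 => by
    rw [dickson_add_two]
    simp only [eval_sub, eval_mul, eval_X, eval_C, dickson_one_eval_add x y (n + 1),
      dickson_one_eval_add x y n]
    ring

lemma natDegree_dickson_one_le {R : Type*} [CommRing R] (a : R) :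
    ∀ n, (dickson 1 a n).natDegree ≤ n
  | 0 => by
    rw [dickson_zero, show (3 : R[X]) - (1 : ℕ) = C (2 : R) by simp [map_ofNat]; norm_num]
    simp
  | 1 => by rw [dickson_one]; exact natDegree_X_le
  | n + 2 => by
    rw [dickson_add_two]
    refine (natDegree_sub_le _ _).trans (max_le ?_ ?_)
    · refine natDegree_mul_le.trans ?_
      have := natDegree_dickson_one_le a (n + 1)
      have := natDegree_X_le (R := R)
      omega
    · refine (natDegree_C_mul_le _ _).trans ?_
      have := natDegree_dickson_one_le a n
      omega

/-- By `X * D n = D (n + 1) + κ D (n - 1)` and `X * D 0 = 2 D 1`, the polynomial `X ^ m` is a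
nonnegative combination of Dickson polynomials. The estimate
`‖Φ p‖ ≤ M r⁻ᵗ p (r + κ / r)` holds for each `D n` and is stable under such combinations; it is
carried through the induction for the products `X ^ m * D n`. -/
theorem norm_dickson_expansion_X_pow_le {F : Type*} [SeminormedAddCommGroup F] [NormedSpace ℝ F]
    (Φ : ℝ[X] →ₗ[ℝ] F) {κ r M : ℝ} (hκ : 0 ≤ κ) (hr : 1 ≤ r) {t : ℕ}
    (hlow : ∀ n < t, Φ (dickson 1 κ n) = 0) (hhigh : ∀ n, ‖Φ (dickson 1 κ n)‖ ≤ M) (m : ℕ) :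
    ‖Φ (X ^ m)‖ ≤ M * r⁻¹ ^ t * (r + κ / r) ^ m := by
  have hr0 : 0 < r := by linarith
  have hM : 0 ≤ M := (norm_nonneg _).trans (hhigh 0)
  have heval : ∀ n, (dickson 1 κ n).eval (r + κ / r) = r ^ n + (κ / r) ^ n := by
    intro n
    rw [← dickson_one_eval_add, mul_div_cancel₀ _ hr0.ne']
  have key : ∀ m n, ‖Φ (X ^ m * dickson 1 κ n)‖ ≤
      M * r⁻¹ ^ t * (X ^ m * dickson 1 κ n).eval (r + κ / r) := by
    intro m
    induction m with
    | zero =>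
      intro n
      rw [pow_zero, one_mul, heval]
      rcases lt_or_ge n t with h | h
      · rw [hlow n h, norm_zero]; positivity
      · refine (hhigh n).trans ?_
        rw [mul_assoc]
        refine le_mul_of_one_le_right hM ?_
        have h1 : r⁻¹ ^ t * r ^ n = r ^ (n - t) := by
          rw [inv_pow, inv_mul_eq_div, pow_sub₀ _ hr0.ne' h, div_eq_mul_inv]
        rw [mul_add, h1]
        have := one_le_pow₀ hr (n := n - t)
        have : 0 ≤ r⁻¹ ^ t * (κ / r) ^ n := by positivity
        linarith
    | succ m ih =>
      intro n
      rcases n with _ | n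
      · have e : X ^ (m + 1) * dickson 1 κ 0 = (2 : ℝ) • (X ^ m * dickson 1 κ 1) := by
          rw [dickson_zero, dickson_one, show (3 : ℝ[X]) - (1 : ℕ) = 2 by norm_num, pow_succ,
            ofNat_smul_eq_nsmul]
          simp only [nsmul_eq_mul]
          push_cast
          ring
        rw [e, map_smul, norm_smul, eval_smul, smul_eq_mul, Real.norm_ofNat]
        linarith [ih 1]
      · have e : X ^ (m + 1) * dickson 1 κ (n + 1) =
            X ^ m * dickson 1 κ (n + 2) + κ • (X ^ m * dickson 1 κ n) := by
          rw [dickson_add_two, smul_eq_C_mul]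
          ring
        rw [e, map_add, map_smul, eval_add, eval_smul, smul_eq_mul]
        refine (norm_add_le _ _).trans ?_
        rw [norm_smul, Real.norm_of_nonneg hκ]
        have := mul_le_mul_of_nonneg_left (ih n) hκ
        linarith [ih (n + 2)]
  have h := key m 0
  have e : X ^ m * dickson 1 κ 0 = (2 : ℝ) • (X ^ m : ℝ[X]) := by
    rw [dickson_zero, show (3 : ℝ[X]) - (1 : ℕ) = 2 by norm_num, ofNat_smul_eq_nsmul]
    simp only [nsmul_eq_mul]
    push_cast
    ring
  rw [e, map_smul, norm_smul, eval_smul, smul_eq_mul, Real.norm_ofNat, eval_pow, eval_X] at h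
  linarith

end Dickson

/-! ### Matrix entries -/

section MatrixBounds

open Complex ComplexConjugate Metric
open scoped InnerProductSpace Nat

open Polynomial Matrix

variable {V : Type*} [Fintype V] [DecidableEq V]

open scoped Matrix.Norms.Operator in
lemma hasSum_exp_apply {𝕜 : Type*} [RCLike 𝕜] (A : Matrix V V 𝕜) (k l : V) :
    HasSum (fun n : ℕ => (n ! : 𝕜)⁻¹ * (A ^ n) k l) (NormedSpace.exp A k l) := by
  have h := NormedSpace.exp_series_hasSum_exp' (𝕂 := 𝕜) A
  exact Pi.hasSum.1 (Pi.hasSum.1 h k) l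

lemma exp_map_ofReal_apply (A : Matrix V V ℝ) (k l : V) :
    NormedSpace.exp (A.map Complex.ofReal) k l = ((NormedSpace.exp A k l : ℝ) : ℂ) := by
  refine (hasSum_exp_apply (A.map Complex.ofReal) k l).unique ?_
  refine (Complex.hasSum_ofReal.2 (hasSum_exp_apply A k l)).congr_fun fun n => ?_
  have : (A.map Complex.ofReal) ^ n = (A ^ n).map Complex.ofReal :=
    (map_pow (Complex.ofRealHom.mapMatrix) A n).symm
  rw [this]
  simp

lemma exp_add_smul_one (B : Matrix V V ℂ) (c : ℂ) :
    NormedSpace.exp (B + c • (1 : Matrix V V ℂ)) = Complex.exp c • NormedSpace.exp B := by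
  rw [Matrix.exp_add_of_commute _ _ ((Commute.one_right B).smul_right c),
    Matrix.smul_one_eq_diagonal, Matrix.exp_diagonal]
  ext i j
  rw [Matrix.mul_diagonal, Pi.coe_exp, ← Complex.exp_eq_exp_ℂ, Matrix.smul_apply, smul_eq_mul,
    mul_comm]

lemma norm_aeval_dickson_apply_le_two {B : Matrix V V ℂ} {κ : ℝ} (hκ0 : 0 ≤ κ) (hκ1 : κ ≤ 1)
    (hB : ∀ x : EuclideanSpace ℂ V, ‖x‖ = 1 → ∃ u v : ℝ, u ^ 2 + v ^ 2 ≤ 1 ∧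
      star x.ofLp ⬝ᵥ B *ᵥ x.ofLp = (1 + κ) * u + (1 - κ) * v * Complex.I) (n : ℕ) (k l : V) :
    ‖aeval B (dickson 1 κ n) k l‖ ≤ 2 := by
  have h := norm_inner_le_two_of_numericalRange_subset_ellipse
    (B := toEuclideanCLM (n := V) (𝕜 := ℂ) B) hκ0 hκ1 (fun x hx => ?_)
    (C := fun n => toEuclideanCLM (n := V) (𝕜 := ℂ) (aeval B (dickson 1 κ n))) ?_ ?_ ?_ n
    (x := EuclideanSpace.single l 1) (y := EuclideanSpace.single k 1) (by simp) (by simp)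
  · simpa [EuclideanSpace.inner_single_left, ofLp_toEuclideanCLM] using h
  · obtain ⟨u, v, huv, e⟩ := hB x hx
    refine ⟨u, v, huv, ?_⟩
    rw [← e, EuclideanSpace.inner_eq_star_dotProduct, ofLp_toEuclideanCLM, dotProduct_comm]
  · rw [dickson_zero, show (3 : ℝ[X]) - (1 : ℕ) = 2 by norm_num, map_ofNat, map_ofNat]
    rw [ofNat_smul_eq_nsmul]; simp
  · simp
  · intro n
    rw [dickson_add_two, map_sub, map_mul, map_mul, aeval_X, aeval_C,
      IsScalarTower.algebraMap_apply ℝ ℂ (Matrix V V ℂ), Algebra.algebraMap_eq_smul_one,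
      smul_mul_assoc, one_mul, map_sub, map_mul, map_smul]
    rfl

end MatrixBounds

/-! ### Walks and powers of the adjacency matrix -/

section Walks

open Complex ComplexConjugate Metric
open scoped InnerProductSpace Nat

namespace WeightedDigraph

variable {V : Type*}

lemma mem_edges_of_adjMatrix_ne_zero {G : WeightedDigraph V} {u v : V}
    (h : G.adjMatrix u v ≠ 0) : (u, v) ∈ G.edges := by
  by_contra hn
  exact h (by simp [adjMatrix, hn])

lemma IsModification.adjMatrix_eq {G G' : WeightedDigraph V} {δE : Set (V × V)}
    (hmod : G.IsModification G' δE) {u v : V} (h : (u, v) ∉ δE) :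
    G'.adjMatrix u v = G.adjMatrix u v := by
  obtain ⟨h1, h2⟩ := hmod _ h
  by_cases he : (u, v) ∈ G.edges
  · simp [adjMatrix, he, h1.2 he, h2 (h1.2 he) he]
  · have : (u, v) ∉ G'.edges := fun hh => he (h1.1 hh)
    simp [adjMatrix, he, this]

variable [Fintype V] [DecidableEq V]

/-- A walk of `G'` is a walk of `G` from its last modified edge on. Hence a nonzero entry
`(u, l)` of the `j`-th power gives a walk of `G` to `l` of length at most `j` that starts at `u`
or at the endpoint of a modified edge. -/
lemma IsModification.exists_walk_of_pow_ne_zero {G G' : WeightedDigraph V} {δE : Set (V × V)}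
    (hmod : G.IsModification G' δE) {l : V} (j : ℕ) : ∀ {u : V}, (G'.adjMatrix ^ j) u l ≠ 0 →
      ∃ v, (v = u ∨ ∃ s, (s, v) ∈ δE) ∧ ∃ p : G.Walk v l, p.length ≤ j := by
  induction j with
  | zero =>
    intro u h
    obtain rfl : u = l := by
      by_contra hne
      exact h (by simp [hne])
    exact ⟨u, Or.inl rfl, .nil, le_rfl⟩
  | succ j ih =>
    intro u h
    rw [pow_succ', Matrix.mul_apply] at h
    obtain ⟨v, -, hv⟩ := Finset.exists_ne_zero_of_sum_ne_zero h
    obtain ⟨w, hw, p, hp⟩ := ih (right_ne_zero_of_mul hv)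
    by_cases hw' : ∃ s, (s, w) ∈ δE
    · exact ⟨w, Or.inr hw', p, hp.trans j.le_succ⟩
    · obtain rfl : w = v := hw.resolve_right hw'
      have huw : (u, w) ∉ δE := fun hh => hw' ⟨u, hh⟩
      have he := mem_edges_of_adjMatrix_ne_zero (hmod.adjMatrix_eq huw ▸ left_ne_zero_of_mul hv)
      exact ⟨u, Or.inl rfl, .cons he p, Nat.succ_le_succ hp⟩

lemma dist_le_of_pow_ne_zero {G : WeightedDigraph V} {u v : V} {i : ℕ}
    (h : (G.adjMatrix ^ i) u v ≠ 0) : G.dist u v ≤ i := by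
  have hself : G.IsModification G ∅ := fun e _ => ⟨Iff.rfl, fun _ _ => rfl⟩
  obtain ⟨w, hw, p, hp⟩ := hself.exists_walk_of_pow_ne_zero i h
  obtain rfl : w = u := by simpa using hw
  exact (iInf_le _ p).trans (by exact_mod_cast hp)

theorem IsModification.pow_adjMatrix_apply_eq {G G' : WeightedDigraph V} {δE : Set (V × V)}
    (hmod : G.IsModification G' δE) {k l : V} {m : ℕ}
    (hm : (m : ℕ∞) ≤ G.distToSet k {s | ∃ t, (s, t) ∈ δE} +
      G.distFromSet {t | ∃ s, (s, t) ∈ δE} l) :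
    (G.adjMatrix ^ m) k l = (G'.adjMatrix ^ m) k l := by
  -- the terms of the telescoping sum for `A ^ m - A' ^ m`
  have hzero : ∀ i j : ℕ, i + 1 + j = m →
      (G.adjMatrix ^ i * (G.adjMatrix - G'.adjMatrix) * G'.adjMatrix ^ j) k l = 0 := by
    intro i j hij
    by_contra h
    rw [Matrix.mul_apply] at h
    obtain ⟨t, -, ht⟩ := Finset.exists_ne_zero_of_sum_ne_zero h
    have h1 := left_ne_zero_of_mul ht
    rw [Matrix.mul_apply] at h1
    obtain ⟨s, -, hs⟩ := Finset.exists_ne_zero_of_sum_ne_zero h1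
    have hst : (s, t) ∈ δE := by
      by_contra hn
      exact right_ne_zero_of_mul hs (by rw [Matrix.sub_apply, hmod.adjMatrix_eq hn, sub_self])
    have hS : G.distToSet k {s | ∃ t, (s, t) ∈ δE} ≤ i :=
      (iInf₂_le s ⟨t, hst⟩).trans (dist_le_of_pow_ne_zero (left_ne_zero_of_mul hs))
    obtain ⟨w, hw, p, hp⟩ := hmod.exists_walk_of_pow_ne_zero j (right_ne_zero_of_mul ht)
    have hwT : ∃ s, (s, w) ∈ δE := by
      rcases hw with rfl | hw
      · exact ⟨s, hst⟩
      · exact hw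
    have hT : G.distFromSet {t | ∃ s, (s, t) ∈ δE} l ≤ j :=
      (iInf₂_le w hwT).trans ((iInf_le _ p).trans (by exact_mod_cast hp))
    have h2 : (m : ℕ∞) ≤ ((i + j : ℕ) : ℕ∞) := by
      push_cast
      exact hm.trans (add_le_add hS hT)
    have h3 : m ≤ i + j := by exact_mod_cast h2
    omega
  have key : ∀ i j : ℕ, i + j = m →
      (G.adjMatrix ^ i * G'.adjMatrix ^ j) k l = (G'.adjMatrix ^ m) k l := by
    intro i
    induction i with
    | zero => intro j hj; rw [pow_zero, one_mul, ← hj, zero_add]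
    | succ i ih =>
      intro j hj
      rw [← ih (j + 1) (by omega), ← sub_eq_zero, ← Matrix.sub_apply, ← hzero i j hj]
      rw [pow_succ, pow_succ', mul_sub, sub_mul]
      simp only [mul_assoc]
  simpa using key m 0 rfl

end WeightedDigraph

end Walks

/-! ### The exponential series -/

section ExpBound

open Complex ComplexConjugate Metric
open scoped InnerProductSpace Nat

open Polynomial

variable {V : Type*} [Fintype V] [DecidableEq V]

lemma aeval_apply_eq_of_pow_apply_eq {R S : Type*} [CommSemiring R] [CommSemiring S] [Algebra R S]
    {M M' : Matrix V V S} {k l : V} {d : ℕ} (h : ∀ m ≤ d, (M ^ m) k l = (M' ^ m) k l)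
    {p : R[X]} (hp : p.natDegree ≤ d) : aeval M p k l = aeval M' p k l := by
  rw [aeval_eq_sum_range, aeval_eq_sum_range, Matrix.sum_apply, Matrix.sum_apply]
  refine Finset.sum_congr rfl fun m hm => ?_
  rw [Matrix.smul_apply, Matrix.smul_apply, h m (by rw [Finset.mem_range] at hm; omega)]

lemma smul_sub_smul_one_pow_apply_eq {M M' : Matrix V V ℂ} {k l : V} {d : ℕ}
    (h : ∀ m ≤ d, (M ^ m) k l = (M' ^ m) k l) (w c : ℂ) (m : ℕ) (hm : m ≤ d) :
    ((w • (M - c • (1 : Matrix V V ℂ))) ^ m) k l =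
      ((w • (M' - c • (1 : Matrix V V ℂ))) ^ m) k l := by
  have e : ∀ N : Matrix V V ℂ,
      (w • (N - c • (1 : Matrix V V ℂ))) ^ m = aeval N ((C w * (X - C c)) ^ m : ℂ[X]) := by
    intro N
    rw [map_pow, map_mul, map_sub, aeval_X, aeval_C, aeval_C, Algebra.algebraMap_eq_smul_one,
      Algebra.algebraMap_eq_smul_one, smul_mul_assoc, one_mul]
  rw [e, e]
  refine aeval_apply_eq_of_pow_apply_eq h (natDegree_pow_le.trans ?_)
  refine le_trans ?_ hm
  refine (Nat.mul_le_mul_left m (?_ : _ ≤ 1)).trans (mul_one m).le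
  exact (natDegree_C_mul_le _ _).trans (natDegree_X_sub_C_le c)

/-- Centering and scaling by `2 / (a + b)` turns the ellipse with semi-axes `a` and `b` into the
one with semi-axes `1 + κ` and `1 - κ`, where `κ = (a - b) / (a + b)`. -/
lemma exists_star_dotProduct_smul_sub_mulVec {A : Matrix V V ℝ} {c : ℂ} {a b : ℝ} (hab : 0 < a + b)
    (hA : ∀ z ∈ fieldOfValues A, ∃ u v : ℝ, u ^ 2 + v ^ 2 ≤ 1 ∧ z = c + (a * u + b * v * I))
    (x : EuclideanSpace ℂ V) (hx : ‖x‖ = 1) : ∃ u v : ℝ, u ^ 2 + v ^ 2 ≤ 1 ∧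
      dotProduct (star x.ofLp) (Matrix.mulVec
        (((2 / (a + b) : ℝ) : ℂ) • (A.map Complex.ofReal - c • (1 : Matrix V V ℂ))) x.ofLp) =
        (1 + ((a - b) / (a + b) : ℝ)) * u + (1 - ((a - b) / (a + b) : ℝ)) * v * I := by
  obtain ⟨u, v, huv, h⟩ := hA _ ⟨x, hx, rfl⟩
  refine ⟨u, v, huv, ?_⟩
  have hxx : dotProduct (star x.ofLp) x.ofLp = 1 := by
    have : ⟪x, x⟫_ℂ = 1 := by rw [inner_self_eq_norm_sq_to_K, hx]; simp
    rwa [EuclideanSpace.inner_eq_star_dotProduct, dotProduct_comm] at this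
  rw [Matrix.smul_mulVec, Matrix.sub_mulVec, Matrix.smul_mulVec, Matrix.one_mulVec,
    dotProduct_smul, dotProduct_sub, dotProduct_smul, hxx, h]
  have hne : (a : ℂ) + b ≠ 0 := by exact_mod_cast hab.ne'
  push_cast
  simp only [smul_eq_mul]
  field_simp
  ring

/-- The bound before the choice of `r`: the exponent `(a + b) / 2 * r + (a - b) / 2 / r` is
`w - c` for the point `w` with parameter `r` of the exterior map of the ellipse. -/
theorem abs_exp_sub_exp_apply_le {A A' : Matrix V V ℝ} {k l : V} {d : ℕ}
    (hagree : ∀ m ≤ d, (A ^ m) k l = (A' ^ m) k l) {c : ℂ} {a b : ℝ} (ha : 0 < a) (hb : 0 ≤ b)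
    (hba : b ≤ a)
    (hA : ∀ z ∈ fieldOfValues A, ∃ u v : ℝ, u ^ 2 + v ^ 2 ≤ 1 ∧ z = c + (a * u + b * v * I))
    (hA' : ∀ z ∈ fieldOfValues A', ∃ u v : ℝ, u ^ 2 + v ^ 2 ≤ 1 ∧ z = c + (a * u + b * v * I))
    {r : ℝ} (hr : 1 ≤ r) :
    |(NormedSpace.exp A - NormedSpace.exp A') k l| ≤
      4 * Real.exp c.re * (r⁻¹ ^ (d + 1) * Real.exp ((a + b) / 2 * r + (a - b) / 2 / r)) := by
  have hab : 0 < a + b := by linarith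
  have hr0 : 0 < r := by linarith
  set κ : ℝ := (a - b) / (a + b) with hκ
  have hκ0 : 0 ≤ κ := div_nonneg (by linarith) hab.le
  have hκ1 : κ ≤ 1 := (div_le_one hab).2 (by linarith)
  set norml : Matrix V V ℝ → Matrix V V ℂ := fun M =>
    ((2 / (a + b) : ℝ) : ℂ) • (M.map Complex.ofReal - c • (1 : Matrix V V ℂ)) with hnorml
  have hpow : ∀ m ≤ d, (A.map Complex.ofReal ^ m) k l = (A'.map Complex.ofReal ^ m) k l := by
    intro m hm
    have e : ∀ M : Matrix V V ℝ, (M.map Complex.ofReal) ^ m = (M ^ m).map Complex.ofReal :=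
      fun M => (map_pow Complex.ofRealHom.mapMatrix M m).symm
    rw [e, e, Matrix.map_apply, Matrix.map_apply, hagree m hm]
  let Φ : ℝ[X] →ₗ[ℝ] ℂ := (Matrix.entryLinearMap ℝ ℂ k l).comp
    ((aeval (norml A)).toLinearMap - (aeval (norml A')).toLinearMap)
  have hΦ : ∀ p, Φ p = aeval (norml A) p k l - aeval (norml A') p k l := fun p => rfl
  have hterm : ∀ m : ℕ, ‖(norml A ^ m) k l - (norml A' ^ m) k l‖ ≤
      4 * r⁻¹ ^ (d + 1) * (r + κ / r) ^ m := by
    intro m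
    have h := norm_dickson_expansion_X_pow_le Φ hκ0 hr (t := d + 1) (M := 4) ?_ ?_ m
    · simpa [hΦ] using h
    · intro n hn
      rw [hΦ, sub_eq_zero]
      exact aeval_apply_eq_of_pow_apply_eq (smul_sub_smul_one_pow_apply_eq hpow _ _)
        ((natDegree_dickson_one_le κ n).trans (by omega))
    · intro n
      rw [hΦ]
      refine (norm_sub_le _ _).trans ?_
      have h1 := norm_aeval_dickson_apply_le_two hκ0 hκ1
        (exists_star_dotProduct_smul_sub_mulVec hab hA) n k l
      have h2 := norm_aeval_dickson_apply_le_two hκ0 hκ1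
        (exists_star_dotProduct_smul_sub_mulVec hab hA') n k l
      linarith
  set α : ℝ := (a + b) / 2 with hα
  have hα0 : 0 < α := by positivity
  have hexp : ∀ M : Matrix V V ℝ, ((NormedSpace.exp M k l : ℝ) : ℂ) =
      Complex.exp c * NormedSpace.exp ((α : ℂ) • norml M) k l := by
    intro M
    have e : (α : ℂ) • norml M + c • (1 : Matrix V V ℂ) = M.map Complex.ofReal := by
      have : (α : ℂ) * ((2 / (a + b) : ℝ) : ℂ) = 1 := by
        rw [← Complex.ofReal_mul, hα]
        norm_cast
        field_simp
      rw [hnorml]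
      simp only
      rw [smul_smul, this, one_smul, sub_add_cancel]
    rw [← exp_map_ofReal_apply, ← e, exp_add_smul_one, Matrix.smul_apply, smul_eq_mul]
  have hsum := (hasSum_exp_apply ((α : ℂ) • norml A) k l).sub
    (hasSum_exp_apply ((α : ℂ) • norml A') k l)
  have hreal : HasSum (fun m : ℕ => 4 * r⁻¹ ^ (d + 1) * ((m ! : ℝ)⁻¹ * (α * (r + κ / r)) ^ m))
      (4 * r⁻¹ ^ (d + 1) * Real.exp (α * (r + κ / r))) := by
    rw [Real.exp_eq_exp_ℝ]
    exact (NormedSpace.exp_series_hasSum_exp' (𝕂 := ℝ) (α * (r + κ / r))).mul_left _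
  have hbound := hsum.norm_le_of_bounded hreal fun m => by
    rw [← mul_sub, norm_mul, norm_inv, Complex.norm_natCast,
      _root_.smul_pow (α : ℂ) (norml A), _root_.smul_pow (α : ℂ) (norml A'),
      Matrix.smul_apply, Matrix.smul_apply, ← smul_sub, norm_smul, norm_pow, Complex.norm_real,
      Real.norm_of_nonneg hα0.le, mul_pow]
    have := mul_le_mul_of_nonneg_left (hterm m) (by positivity : 0 ≤ (m ! : ℝ)⁻¹ * α ^ m)
    linarith
  have e1 : |(NormedSpace.exp A - NormedSpace.exp A') k l| = Real.exp c.re *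
      ‖NormedSpace.exp ((α : ℂ) • norml A) k l - NormedSpace.exp ((α : ℂ) • norml A') k l‖ := by
    rw [← Complex.norm_exp, ← norm_mul, mul_sub, ← hexp, ← hexp, ← Complex.ofReal_sub,
      Complex.norm_real, Matrix.sub_apply, Real.norm_eq_abs]
  have e2 : α * (r + κ / r) = α * r + (a - b) / 2 / r := by
    rw [hα, hκ]; field_simp
  rw [e1, ← e2]
  have := mul_le_mul_of_nonneg_left hbound (Real.exp_pos c.re).le
  linarith

end ExpBound

/-! ### The optimal radius -/

section Parameters

open Complex ComplexConjugate Metric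
open scoped InnerProductSpace Nat

/-- The radius `r = t p(t) / (a + b)` solves `(a + b) / 2 * r² - t r - (a - b) / 2 = 0`, the
critical point equation of the exponent `(a + b) / 2 * r + (a - b) / 2 / r - t log r`. Both claims
reduce to polynomial identities in `s = √(1 + R / t²)`, as `p = 1 + s` and `q = s`. -/
lemma optimal_radius_bound {R a b t : ℝ} (hR : R = a ^ 2 - b ^ 2) (hR0 : 0 ≤ R) (hab : 0 < a + b)
    (ht : 0 < t) (hbt : b < t) (hb : 0 ≤ b) :
    1 < t * expBoundP R t / (a + b) ∧
    (a + b) / 2 * (t * expBoundP R t / (a + b)) + (a - b) / 2 / (t * expBoundP R t / (a + b)) =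
      expBoundQ R t * t := by
  have hs : √(t ^ 2 + R) = t * √(1 + R / t ^ 2) := by
    rw [show t ^ 2 + R = t ^ 2 * (1 + R / t ^ 2) by field_simp, Real.sqrt_mul (by positivity),
      Real.sqrt_sq ht.le]
  have hsq : √(1 + R / t ^ 2) ^ 2 = 1 + R / t ^ 2 := Real.sq_sqrt (by positivity)
  unfold expBoundP expBoundQ
  rw [hs]
  set s := √(1 + R / t ^ 2) with hsdef
  have hs0 : 0 ≤ s := Real.sqrt_nonneg _
  have hRs : R = t ^ 2 * (s - 1) * (s + 1) := by
    have : R / t ^ 2 = s ^ 2 - 1 := by linarith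
    rw [div_eq_iff (by positivity)] at this
    rw [this]; ring
  have hfac : (a - b) * (a + b) = t ^ 2 * (s - 1) * (s + 1) := by rw [← hRs, hR]; ring
  constructor
  · rw [one_lt_div hab]
    have h1 : a ^ 2 < (t * s) ^ 2 := by
      have : (t * s) ^ 2 = t ^ 2 + R := by rw [hRs]; ring
      rw [this, hR]
      nlinarith
    have h2 : a < t * s := lt_of_pow_lt_pow_left₀ 2 (by positivity) h1
    linarith
  · have hs1 : 0 < 1 + s := by linarith
    rw [show (a - b) = t ^ 2 * (s - 1) * (s + 1) / (a + b) by rw [← hfac]; field_simp, hRs]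
    field_simp
    ring

lemma bound_le_bound_with_geometric_factor {E p q w t : ℝ} (n : ℕ) (hn : t = n) (hE : 0 ≤ E)
    (hw : 0 < w) (hr : 1 < t * p / w) (ht : 0 < t) :
    4 * E * ((t * p / w)⁻¹ ^ n * Real.exp (q * t)) ≤
      4 * E * p / (p - w / t) * (w / t * (Real.exp q / p)) ^ n := by
  have hp : w / t < p := by
    rw [one_lt_div hw] at hr
    rw [div_lt_iff₀ ht]; linarith
  have hp0 : 0 < p := lt_trans (by positivity) hp
  have e : (t * p / w)⁻¹ ^ n * Real.exp (q * t) = (w / t * (Real.exp q / p)) ^ n := by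
    rw [hn, mul_comm q, Real.exp_nat_mul, ← mul_pow, ← hn]
    congr 1
    field_simp
  rw [e]
  refine mul_le_mul_of_nonneg_right ?_ (by positivity)
  rw [mul_div_assoc]
  refine le_mul_of_one_le_right (by positivity) ?_
  rw [one_le_div (by linarith)]
  have : 0 < w / t := by positivity
  linarith

end Parameters

/-! ### Elliptic regions -/

section Regions

open Complex ComplexConjugate Metric
open scoped InnerProductSpace Nat

lemma IsPreconnected.inter_frontier_nonempty {X : Type*} [TopologicalSpace X] {s t : Set X}
    (hs : IsPreconnected s) (h1 : (s ∩ t).Nonempty) (h2 : (s ∩ tᶜ).Nonempty) :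
    (s ∩ frontier t).Nonempty := by
  by_contra hne
  have hfr : ∀ x ∈ s, x ∉ frontier t := fun x hx hxf => hne ⟨x, hx, hxf⟩
  have hint : ∀ x ∈ s, x ∈ t → x ∈ interior t := fun x hx hxt => by
    by_contra hi
    exact hfr x hx ⟨subset_closure hxt, hi⟩
  have hext : ∀ x ∈ s, x ∉ t → x ∈ (closure t)ᶜ := fun x hx hxt hc =>
    hfr x hx ⟨hc, fun hi => hxt (interior_subset hi)⟩
  obtain ⟨x, hx, hxt⟩ := h1
  obtain ⟨y, hy, hyt⟩ := h2
  obtain ⟨w, -, hw1, hw2⟩ := hs _ _ isOpen_interior isClosed_closure.isOpen_compl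
    (fun z hz => (em (z ∈ t)).imp (hint z hz) (hext z hz))
    ⟨x, hx, hint x hx hxt⟩ ⟨y, hy, hext y hy hyt⟩
  exact hw2 (subset_closure (interior_subset hw1))

/-- A bounded set whose frontier is an ellipse lies in the filled ellipse: the ray from the center
that continues beyond an outside point of the set leaves the set, hence crosses its frontier, but
never meets the ellipse. -/
lemma le_one_of_mem_of_frontier_eq_horizontalEllipse {Ω : Set ℂ} {c : ℂ} {a b : ℝ}
    (hΩ : Bornology.IsBounded Ω) (hfr : frontier Ω = horizontalEllipse c a b) {z : ℂ}
    (hz : z ∈ Ω) : ((z.re - c.re) / a) ^ 2 + ((z.im - c.im) / b) ^ 2 ≤ 1 := by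
  by_contra! hlt
  set f : ℝ → ℂ := fun s => c + s * (z - c) with hf
  have hzc : z - c ≠ 0 := by
    intro h
    rw [sub_eq_zero.1 h] at hlt
    norm_num at hlt
  have hpre : IsPreconnected (f '' Set.Ici 1) :=
    isPreconnected_Ici.image _ (by fun_prop)
  have h1 : (f '' Set.Ici 1 ∩ Ω).Nonempty := ⟨z, ⟨1, Set.self_mem_Ici, by simp [hf]⟩, hz⟩
  have h2 : (f '' Set.Ici 1 ∩ Ωᶜ).Nonempty := by
    obtain ⟨ρ, hρ⟩ := hΩ.subset_closedBall c
    have hpos : 0 < ‖z - c‖ := norm_pos_iff.2 hzc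
    refine ⟨f (max 1 ((|ρ| + 1) / ‖z - c‖)), ⟨_, Set.mem_Ici.2 (le_max_left _ _), rfl⟩, fun hmem => ?_⟩
    have h3 := hρ hmem
    have h4 : (|ρ| + 1) / ‖z - c‖ ≤ max 1 ((|ρ| + 1) / ‖z - c‖) := le_max_right _ _
    rw [div_le_iff₀ hpos] at h4
    rw [hf, mem_closedBall, dist_eq_norm, add_sub_cancel_left, norm_mul, Complex.norm_real,
      Real.norm_of_nonneg (by positivity)] at h3
    linarith [le_abs_self ρ]
  obtain ⟨y, ⟨s, hs, rfl⟩, hy⟩ := hpre.inter_frontier_nonempty h1 h2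
  rw [hfr] at hy
  simp only [horizontalEllipse, Set.mem_ofPred_eq, hf, Complex.add_re, Complex.add_im,
    Complex.re_ofReal_mul, Complex.im_ofReal_mul, Complex.sub_re, Complex.sub_im,
    add_sub_cancel_left] at hy
  have hs' : (1 : ℝ) ≤ s := hs
  have e : (s * (z.re - c.re) / a) ^ 2 + (s * (z.im - c.im) / b) ^ 2 =
      s ^ 2 * (((z.re - c.re) / a) ^ 2 + ((z.im - c.im) / b) ^ 2) := by ring
  rw [e] at hy
  have : 1 ≤ s ^ 2 := one_le_pow₀ hs'
  nlinarith

lemma exists_eq_add_of_ellipse {c z : ℂ} {a b : ℝ} (ha : 0 < a) (hb : 0 < b)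
    (h : ((z.re - c.re) / a) ^ 2 + ((z.im - c.im) / b) ^ 2 ≤ 1) :
    ∃ u v : ℝ, u ^ 2 + v ^ 2 ≤ 1 ∧ z = c + (a * u + b * v * I) := by
  refine ⟨_, _, h, Complex.ext ?_ ?_⟩
  · simp; field_simp; ring
  · simp; field_simp; ring

end Regions

theorem corollary5p4 {V : Type*} [Fintype V] [DecidableEq V]
    (G G' : WeightedDigraph V) (δE : Set (V × V)) (hmod : G.IsModification G' δE)
    (S T : Set V) (hS : S = {s | ∃ t, (s, t) ∈ δE}) (hT : T = {t | ∃ s, (s, t) ∈ δE})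
    (k l : V) (δ : ℕ∞) (hδ : δ = G.distToSet k S + G.distFromSet T l) :
    -- infinite distance: the limit case, in which every bound below is `0`
    (δ = ⊤ → NormedSpace.exp G.adjMatrix k l = NormedSpace.exp G'.adjMatrix k l) ∧
    -- finite distance `δ = d`
    (∀ d : ℕ, δ = d →
      -- the boundary of `Ω` is a horizontal ellipse
      (∀ (Ω : Set ℂ) (c : ℂ) (a b : ℝ), 0 < b → b ≤ a →
        Bornology.IsBounded Ω → frontier Ω = horizontalEllipse c a b →
        fieldOfValues G.adjMatrix ⊆ Ω → fieldOfValues G'.adjMatrix ⊆ Ω →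
        b - 1 < (d : ℝ) →
        |(NormedSpace.exp G.adjMatrix - NormedSpace.exp G'.adjMatrix) k l| ≤
          4 * Real.exp c.re * expBoundP (a ^ 2 - b ^ 2) (d + 1) /
              (expBoundP (a ^ 2 - b ^ 2) (d + 1) - (a + b) / (d + 1)) *
            ((a + b) / (d + 1) * (Real.exp (expBoundQ (a ^ 2 - b ^ 2) (d + 1)) /
              expBoundP (a ^ 2 - b ^ 2) (d + 1))) ^ (d + 1)) ∧
      -- `Ω` is a disk
      (∀ (c : ℂ) (a : ℝ), 0 < a →
        fieldOfValues G.adjMatrix ⊆ Metric.closedBall c a →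
        fieldOfValues G'.adjMatrix ⊆ Metric.closedBall c a →
        a - 1 < (d : ℝ) →
        |(NormedSpace.exp G.adjMatrix - NormedSpace.exp G'.adjMatrix) k l| ≤
          4 * Real.exp c.re * ((d + 1) / (d + 1 - a)) *
            (a * Real.exp 1 / (d + 1)) ^ (d + 1)) ∧
      -- `Ω` is a real interval
      (∀ c a : ℝ, 0 < a →
        fieldOfValues G.adjMatrix ⊆ Complex.ofReal '' Set.Icc (c - a) (c + a) →
        fieldOfValues G'.adjMatrix ⊆ Complex.ofReal '' Set.Icc (c - a) (c + a) →
        0 < d →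
        |(NormedSpace.exp G.adjMatrix - NormedSpace.exp G'.adjMatrix) k l| ≤
          4 * Real.exp c * expBoundP (a ^ 2) (d + 1) /
              (expBoundP (a ^ 2) (d + 1) - a / (d + 1)) *
            (a / (d + 1) * (Real.exp (expBoundQ (a ^ 2) (d + 1)) /
              expBoundP (a ^ 2) (d + 1))) ^ (d + 1))) := by
  have hagree : ∀ m : ℕ, (m : ℕ∞) ≤ δ → (G.adjMatrix ^ m) k l = (G'.adjMatrix ^ m) k l := by
    intro m hm
    subst hδ hS hT
    exact hmod.pow_adjMatrix_apply_eq hm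
  refine ⟨fun htop => ?_, fun d hd => ?_⟩
  · refine (hasSum_exp_apply G.adjMatrix k l).unique ?_
    convert hasSum_exp_apply G'.adjMatrix k l using 3 with m
    exact hagree m (htop ▸ le_top)
  have hagree' : ∀ m ≤ d, (G.adjMatrix ^ m) k l = (G'.adjMatrix ^ m) k l := fun m hm =>
    hagree m (hd ▸ by exact_mod_cast hm)
  have ht : (0 : ℝ) < d + 1 := by positivity
  have htn : (d : ℝ) + 1 = ((d + 1 : ℕ) : ℝ) := by push_cast; rfl
  refine ⟨fun Ω c a b hb hba hΩ hfr hA hA' hbd => ?_, fun c a ha hA hA' had => ?_,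
    fun c a ha hA hA' _ => ?_⟩
  · have ha : 0 < a := hb.trans_le hba
    have hmem : ∀ z ∈ Ω, ∃ u v : ℝ, u ^ 2 + v ^ 2 ≤ 1 ∧ z = c + (a * u + b * v * Complex.I) :=
      fun z hz => exists_eq_add_of_ellipse ha hb
        (le_one_of_mem_of_frontier_eq_horizontalEllipse hΩ hfr hz)
    obtain ⟨hr, he⟩ := optimal_radius_bound (R := a ^ 2 - b ^ 2) (a := a) (b := b) rfl
      (by nlinarith) (by linarith) ht (by linarith) hb.le
    refine (abs_exp_sub_exp_apply_le hagree' ha hb.le hba (fun z hz => hmem z (hA hz))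
      (fun z hz => hmem z (hA' hz)) hr.le).trans ?_
    rw [he]
    exact bound_le_bound_with_geometric_factor (d + 1) htn (Real.exp_pos _).le (by linarith) hr ht
  · have hmem : ∀ z ∈ Metric.closedBall c a,
        ∃ u v : ℝ, u ^ 2 + v ^ 2 ≤ 1 ∧ z = c + (a * u + a * v * Complex.I) := by
      intro z hz
      refine exists_eq_add_of_ellipse ha ha ?_
      rw [Metric.mem_closedBall, Complex.dist_eq_re_im, Real.sqrt_le_left ha.le] at hz
      rw [div_pow, div_pow, ← add_div]
      exact (div_le_one (by positivity)).2 hz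
    have hr : 1 < (d + 1) * 2 / (a + a) := by
      rw [one_lt_div (by linarith)]; linarith
    refine (abs_exp_sub_exp_apply_le hagree' ha ha.le le_rfl (fun z hz => hmem z (hA hz))
      (fun z hz => hmem z (hA' hz)) hr.le).trans ?_
    have he : (a + a) / 2 * ((d + 1) * 2 / (a + a)) + (a - a) / 2 / ((d + 1) * 2 / (a + a)) =
        1 * ((d : ℝ) + 1) := by
      field_simp; ring
    rw [he]
    refine (bound_le_bound_with_geometric_factor (d + 1) htn (Real.exp_pos _).le
      (by linarith) hr ht).trans_eq ?_
    have hda : (d : ℝ) + 1 - a ≠ 0 := (by linarith : (0 : ℝ) < d + 1 - a).ne'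
    have e1 : 4 * Real.exp c.re * 2 / (2 - (a + a) / (d + 1)) =
        4 * Real.exp c.re * ((d + 1) / (d + 1 - a)) := by
      have : 2 - (a + a) / ((d : ℝ) + 1) = 2 * ((d + 1 - a) / (d + 1)) := by field_simp; ring
      rw [this]
      field_simp
    rw [e1]
    congr 2
    field_simp
    ring
  · have hmem : ∀ z ∈ Complex.ofReal '' Set.Icc (c - a) (c + a), ∃ u v : ℝ, u ^ 2 + v ^ 2 ≤ 1 ∧
        z = (c : ℂ) + (a * u + (0 : ℝ) * v * Complex.I) := by
      rintro _ ⟨x, ⟨hx1, hx2⟩, rfl⟩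
      refine ⟨(x - c) / a, 0, ?_, ?_⟩
      · have : |(x - c) / a| ≤ 1 := by
          rw [abs_div, abs_of_pos ha, div_le_one ha, abs_le]
          constructor <;> linarith
        have := (sq_le_one_iff_abs_le_one _).2 this
        linarith
      · have : (a : ℂ) ≠ 0 := by exact_mod_cast ha.ne'
        push_cast
        field_simp
        ring
    obtain ⟨hr, he⟩ := optimal_radius_bound (R := a ^ 2) (a := a) (b := 0) (by ring)
      (by positivity) (by linarith) ht ht le_rfl
    refine (abs_exp_sub_exp_apply_le hagree' ha le_rfl ha.le (fun z hz => hmem z (hA hz))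
      (fun z hz => hmem z (hA' hz)) hr.le).trans ?_
    rw [he]
    refine (bound_le_bound_with_geometric_factor (d + 1) htn (Real.exp_pos _).le
      (by linarith) hr ht).trans_eq ?_
    rw [add_zero, Complex.ofReal_re]
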